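/- Let $\mathcal H$ be a real Hilbert space. For a nonempty closed convex set $C\subseteq\mathcal H$ let $P_C$ be the projector onto $C$ and $R_C:=2P_C-\mathrm{Id}$ the reflector. For a nonempty finite set $K\subseteq\mathcal H$, the circumcenter of $K$ is the (necessarily unique) point $p$ of the affine hull of $K$ that is equidistant from all points of $K$, if such a point exists. For a finite set $\mathcal S$ of operators $\mathcal H\to\mathcal H$, let $CC_{\mathcal S}x$ be the circumcenter of $\{Tx : T\in\mathcal S\}$, if it exists. The circumcentered reflection method (CRM) induced by $\mathcal S$ with initial point $x$ generates the iterates $CC_{\mathcal S}^k x$, $k=0,1,2,\dots$. It finds a point in (at most) $n$ steps if that point is $CC_{\mathcal S}^k x$ for some $k\in\{1,\dots,n\}$; this includes that the circumcenters needed to form $CC_{\mathcal S}^kx$ exist. Theorem. Let $u_1,u_2\in\mathcal H$ and $\eta_1,\eta_2\in\mathbb R$ be arbitrary (the $u_i$ may be zero), and for $i\in\{1,2\}$ set $$W_i:=\{x\in\mathcal H : \langle x,u_i\rangle\le\eta_i\},\qquad H_i:=\{x\in\mathcal H : \langle x,u_i\rangle=\eta_i\}.$$ 1. Assume $H_1\cap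 H_2\ne\varnothing$. Then for every $x\in\mathcal H$ the CRM induced by $\{\mathrm{Id},R_{H_1},R_{H_2}R_{H_1}\}$ finds $P_{H_1\cap H_2}x$ in at most $3$ steps. 2. Assume that $u_1,u_2$ are linearly dependent and $W_1\cap W_2\ne\varnothing$. Then for every $x\in W_1\cup W_2$ the CRM induced by $\{\mathrm{Id},R_{W_1},R_{W_2}\}$ with initial point $x$ finds $P_{W_1\cap W_2}x$ in one step. 3. Assume that $u_1,u_2$ are linearly dependent and $W_1\cap W_2\ne\varnothing$. Then for every $x\in W_1$ the CRM induced by $\{\mathrm{Id},R_{W_1},R_{W_2}R_{W_1}\}$ with initial point $x$ finds $P_{W_1\cap W_2}x$ in one step. 4. Assume that $u_1,u_2$ are linearly independent. Then for every $x\in\mathcal H$ the CRM induced by $\{\mathrm{Id},R_{W_1},R_{W_2}R_{W_1}\}$ with initial point $x$ finds a point of $W_1\cap W_2$ in at most two steps. 5. Assume $H_1\cap W_2\ne\varnothing$. (a) If $u_1=0$ or $u_2=0$, then $CC_{\mathcal S}x=P_{H_1\cap W_2}x$ for every $x\in\mathcal H$ and for each of $\mathcal S=\{\mathrm{Id},R_{H_1},R_{W_2}\}$,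 $\mathcal S=\{\mathrm{Id},R_{H_1},R_{W_2}R_{H_1}\}$ and $\mathcal S=\{\mathrm{Id},R_{W_2},R_{H_1}R_{W_2}\}$. (b) If $u_1,u_2$ are nonzero and linearly dependent, then $P_{H_1}x=P_{H_1\cap W_2}x$ for every $x\in\mathcal H$. (c) In all cases other than $u_1=u_2=0$ and that of (b), with the exception of the case $u_2=0\ne\eta_2$ (in which $H_2=\varnothing$), we have $H_1\cap H_2\neq\varnothing$, and for every $x\in\mathcal H$ the CRM induced by $\{\mathrm{Id},R_{H_1},R_{H_2}R_{H_1}\}$ with initial point $x$ finds $P_{H_1\cap H_2}x$, which is a point of $H_1\cap W_2$, in at most $3$ steps. -/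

import Mathlib

namespace CRM

variable {E : Type*} [NormedAddCommGroup E] [InnerProductSpace ℝ E]

/-- `p` is a projection (best approximation) of `x` onto `C`. -/
def IsProj (C : Set E) (x p : E) : Prop :=
  p ∈ C ∧ ∀ y ∈ C, ‖x - p‖ ≤ ‖x - y‖

theorem exists_isProj [CompleteSpace E] {C : Set E} (hne : C.Nonempty) (hcl : IsClosed C)
    (hconv : Convex ℝ C) (x : E) : ∃ p, IsProj C x p := by
  obtain ⟨p, hp, hpx⟩ := exists_norm_eq_iInf_of_complete_convex hne hcl.isComplete hconv x
  refine ⟨p, hp, fun y hy => ?_⟩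
  rw [hpx]
  exact ciInf_le (f := fun w : C => ‖x - w‖)
    ⟨0, by rintro _ ⟨w, rfl⟩; exact norm_nonneg _⟩ ⟨y, hy⟩

theorem IsProj.inner_le {C : Set E} (hconv : Convex ℝ C) {x p : E} (hp : IsProj C x p) :
    ∀ y ∈ C, inner ℝ (x - p) (y - p) ≤ 0 := by
  refine (norm_eq_iInf_iff_real_inner_le_zero hconv hp.1).1 (le_antisymm ?_ ?_)
  · have : Nonempty C := ⟨⟨p, hp.1⟩⟩
    exact le_ciInf fun w => hp.2 w w.2
  · exact ciInf_le (f := fun w : C => ‖x - w‖)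
      ⟨0, by rintro _ ⟨w, rfl⟩; exact norm_nonneg _⟩ ⟨p, hp.1⟩

theorem IsProj.unique {C : Set E} (hconv : Convex ℝ C) {x p q : E}
    (hp : IsProj C x p) (hq : IsProj C x q) : p = q := by
  have h1 := hp.inner_le hconv q hq.1
  have h2 := hq.inner_le hconv p hp.1
  have h3 : inner ℝ (q - p) (q - p) ≤ (0 : ℝ) := by
    have e : inner ℝ (q - p) (q - p)
        = inner ℝ (x - p) (q - p) + inner ℝ (x - q) (p - q) := by
      rw [← neg_sub q p, inner_neg_right, ← sub_eq_add_neg, ← inner_sub_left]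
      congr 1
      abel
    rw [e]
    linarith
  have h4 : q - p = 0 := by
    rw [real_inner_self_eq_norm_sq] at h3
    have : ‖q - p‖ = 0 := by nlinarith [norm_nonneg (q - p)]
    exact norm_eq_zero.1 this
  exact (sub_eq_zero.1 h4).symm

open Classical in
/-- The projector onto `C`. For `C` nonempty, closed and convex in a Hilbert space, `proj C x` is
the unique projection of `x` onto `C` (`proj_eq_iff` below); the value is irrelevant where no
projection exists. -/
noncomputable def proj (C : Set E) (x : E) : E :=
  if h : ∃ p, IsProj C x p then h.choose else x

theorem proj_eq_iff [CompleteSpace E] {C : Set E} (hne : C.Nonempty) (hcl : IsClosed C)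
    (hconv : Convex ℝ C) (x p : E) : proj C x = p ↔ IsProj C x p := by
  have h := exists_isProj hne hcl hconv x
  have hs : IsProj C x (proj C x) := by
    unfold proj
    rw [dif_pos h]
    exact h.choose_spec
  exact ⟨fun e => e ▸ hs, fun hp => hs.unique hconv hp⟩

/-- The reflector `2 P_C - Id` associated with `C`. -/
noncomputable def refl (C : Set E) (x : E) : E :=
  (2 : ℝ) • proj C x - x

/-- `p` lies in the affine hull of `K` and `{‖p - x‖ : x ∈ K}` is a singleton. -/
def IsCircumcenter (K : Set E) (p : E) : Prop :=
  p ∈ affineSpan ℝ K ∧ ∃ r : ℝ, (fun x => ‖p - x‖) '' K = {r}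

theorem IsCircumcenter.unique {K : Set E} {p q : E} (hp : IsCircumcenter K p)
    (hq : IsCircumcenter K q) : p = q := by
  obtain ⟨hpK, r, hr⟩ := hp
  obtain ⟨hqK, s, hs⟩ := hq
  have hr' : ∀ x ∈ K, ‖p - x‖ = r := fun x hx => by
    have : ‖p - x‖ ∈ (fun x => ‖p - x‖) '' K := ⟨x, hx, rfl⟩
    rwa [hr] at this
  have hs' : ∀ x ∈ K, ‖q - x‖ = s := fun x hx => by
    have : ‖q - x‖ ∈ (fun x => ‖q - x‖) '' K := ⟨x, hx, rfl⟩
    rwa [hs] at this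
  have key : ∀ x ∈ K, ∀ y ∈ K, inner ℝ (p - q) (x - y) = (0 : ℝ) := by
    intro x hx y hy
    have e1 := norm_sub_sq_real p x
    have e2 := norm_sub_sq_real p y
    have e3 := norm_sub_sq_real q x
    have e4 := norm_sub_sq_real q y
    rw [hr' x hx] at e1
    rw [hr' y hy] at e2
    rw [hs' x hx] at e3
    rw [hs' y hy] at e4
    simp only [inner_sub_left, inner_sub_right]
    linarith
  have hmem : p - q ∈ vectorSpan ℝ K := by
    rw [← direction_affineSpan]
    exact AffineSubspace.vsub_mem_direction hpK hqK
  have hall : ∀ v ∈ vectorSpan ℝ K, inner ℝ (p - q) v = (0 : ℝ) := by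
    intro v hv
    rw [vectorSpan_def] at hv
    induction hv using Submodule.span_induction with
    | mem v hv =>
      obtain ⟨x, hx, y, hy, rfl⟩ := Set.mem_vsub.1 hv
      exact key x hx y hy
    | zero => exact inner_zero_right _
    | add a b _ _ ha hb => rw [inner_add_right, ha, hb, add_zero]
    | smul c a _ ha => rw [inner_smul_right, ha, mul_zero]
  exact sub_eq_zero.1 (inner_self_eq_zero.1 (hall _ hmem))

open Classical in
/-- The circumcenter operator: the circumcenter of `K`, which is unique by
`IsCircumcenter.unique`, or `none` if it does not exist. -/
noncomputable def circumcenter (K : Set E) : Option E :=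
  if h : ∃ p, IsCircumcenter K p then some h.choose else none

theorem circumcenter_eq_some_iff (K : Set E) (p : E) :
    circumcenter K = some p ↔ IsCircumcenter K p := by
  unfold circumcenter
  split_ifs with h
  · rw [Option.some_inj]
    exact ⟨fun e => e ▸ h.choose_spec, fun hp => h.choose_spec.unique hp⟩
  · exact ⟨fun e => by simp at e, fun hp => (h ⟨p, hp⟩).elim⟩

/-- The circumcenter mapping induced by a set `S` of operators: it sends `x` to the circumcenter
of `S(x) = {T x : T ∈ S}`. -/
noncomputable def circumMap (S : Set (E → E)) (x : E) : Option E :=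
  circumcenter ((fun T : E → E => T x) '' S)

/-- The `k`-th iterate of the circumcentered method induced by `S` with initial point `x`; it is
`none` as soon as one of the circumcenters on the way does not exist. -/
noncomputable def iter (S : Set (E → E)) : ℕ → E → Option E
  | 0, x => some x
  | k + 1, x => (iter S k x).bind (circumMap S)

end CRM

namespace CRM

/-! Outside a halfspace, and always for a hyperplane, the projection of `x` is `x - t • u` and the
reflection is `x - (2 * t) • u`; the argument turns on which parameters vanish. If only two points
remain, the circumcenter is their midpoint, a plain projection (`isCircumcenter_pair`).

If both successive reflections move the point and the normals are independent, the bisectors of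
consecutive points are the boundary hyperplanes `H₁` and `H₂`, and the affine hull is `x + span {u,
v}`, which meets `H₁ ∩ H₂`; the meeting point is the circumcenter (`exists_mem_hyperplanes`,
`isCircumcenter_triple`). For hyperplanes, at most two collapsed steps precede the last one, and the
iterates never leave `x + span {u, v}`, so the point reached is the projection of the initial point
(`isProj_hyperplane_inter`). For halfspaces, a collapsed first step either lands in `W₁ ∩ W₂` or
leaves one step to go.

With dependent normals the boundaries are parallel and a single projection suffices
(`proj_halfspace_inter_of_mem`, `hyperplane_subset_halfspace`). -/

/-- A projection onto a larger set that lands in a smaller one is the projection onto it. -/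
theorem IsProj.mono {E : Type*} [NormedAddCommGroup E] {C D : Set E} {x p : E} (hp : IsProj C x p) (hDC : D ⊆ C) (hpD : p ∈ D) :
    IsProj D x p :=
  ⟨hpD, fun y hy => hp.2 y (hDC hy)⟩

/-! ### Explicit projections, circumcenters of two and three points, and single steps of the method.
-/

section

variable {E : Type*} [NormedAddCommGroup E] [InnerProductSpace ℝ E]

theorem convex_halfspace (u : E) (η : ℝ) : Convex ℝ {x : E | inner ℝ x u ≤ η} := by
  intro x hx y hy a b ha hb hab
  simp only [Set.mem_ofPred_eq, inner_add_left, inner_smul_left] at *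
  simp only [conj_trivial]
  have h : a * η + b * η = η := by rw [← add_mul, hab, one_mul]
  linarith [mul_le_mul_of_nonneg_left hx ha, mul_le_mul_of_nonneg_left hy hb]

theorem convex_hyperplane (u : E) (η : ℝ) : Convex ℝ {x : E | inner ℝ x u = η} := by
  intro x hx y hy a b ha hb hab
  simp only [Set.mem_ofPred_eq, inner_add_left, inner_smul_left] at *
  simp only [conj_trivial]
  rw [hx, hy, ← add_mul, hab, one_mul]

theorem IsProj.proj_eq {C : Set E} (hconv : Convex ℝ C) {x p : E} (hp : IsProj C x p) :
    proj C x = p := by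
  have h : ∃ p, IsProj C x p := ⟨p, hp⟩
  unfold proj
  rw [dif_pos h]
  exact h.choose_spec.unique hconv hp

theorem isProj_of_inner_le {C : Set E} {x p : E} (hp : p ∈ C)
    (h : ∀ y ∈ C, inner ℝ (x - p) (y - p) ≤ 0) : IsProj C x p := by
  refine ⟨hp, fun y hy => ?_⟩
  have e : ‖x - y‖ ^ 2 = ‖x - p‖ ^ 2 - 2 * inner ℝ (x - p) (y - p) + ‖y - p‖ ^ 2 := by
    rw [← norm_sub_sq_real]
    congr 2
    abel
  have h1 := h y hy
  exact abs_le_of_sq_le_sq' (by nlinarith [sq_nonneg ‖y - p‖]) (norm_nonneg _) |>.2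

theorem isProj_self {C : Set E} {x : E} (hx : x ∈ C) : IsProj C x x :=
  isProj_of_inner_le hx fun y _ => by simp

theorem refl_of_mem {C : Set E} (hconv : Convex ℝ C) {x : E} (hx : x ∈ C) : refl C x = x := by
  rw [refl, (isProj_self hx).proj_eq hconv, two_smul, add_sub_cancel_right]

theorem refl_of_isProj {C : Set E} (hconv : Convex ℝ C) {x u : E} {t : ℝ}
    (hp : IsProj C x (x - t • u)) : refl C x = x - (2 * t) • u := by
  rw [refl, hp.proj_eq hconv]
  module

theorem exists_inner_sub_smul_eq {u : E} (hu : u ≠ 0) (η : ℝ) (x : E) :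
    ∃ t : ℝ, inner ℝ (x - t • u) u = η ∧ t * ‖u‖ ^ 2 = inner ℝ x u - η := by
  have hu' : ‖u‖ ^ 2 ≠ 0 := pow_ne_zero 2 (norm_ne_zero_iff.2 hu)
  have h : (inner ℝ x u - η) / ‖u‖ ^ 2 * ‖u‖ ^ 2 = inner ℝ x u - η := div_mul_cancel₀ _ hu'
  refine ⟨(inner ℝ x u - η) / ‖u‖ ^ 2, ?_, h⟩
  rw [inner_sub_left, real_inner_smul_left, real_inner_self_eq_norm_sq, h]
  ring

theorem exists_isProj_hyperplane {u : E} {η : ℝ} (hne : {x : E | inner ℝ x u = η}.Nonempty)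
    (x : E) : ∃ t : ℝ, inner ℝ (x - t • u) u = η ∧
      IsProj {x : E | inner ℝ x u = η} x (x - t • u) := by
  obtain ⟨t, ht⟩ : ∃ t : ℝ, inner ℝ (x - t • u) u = η := by
    rcases eq_or_ne u 0 with rfl | hu
    · obtain ⟨z, hz⟩ := hne
      exact ⟨0, by simpa using hz⟩
    · obtain ⟨t, ht, -⟩ := exists_inner_sub_smul_eq hu η x
      exact ⟨t, ht⟩
  refine ⟨t, ht, isProj_of_inner_le ht fun y hy => le_of_eq ?_⟩
  have hy' : inner ℝ y u = η := hy
  rw [sub_sub_cancel, real_inner_smul_left, real_inner_comm, inner_sub_left, hy', ht, sub_self,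
    mul_zero]

theorem exists_isProj_halfspace {u : E} {η : ℝ} (hne : {x : E | inner ℝ x u ≤ η}.Nonempty)
    {x : E} (hx : η < inner ℝ x u) : ∃ t : ℝ, 0 < t ∧ inner ℝ (x - t • u) u = η ∧
      IsProj {x : E | inner ℝ x u ≤ η} x (x - t • u) := by
  have hu : u ≠ 0 := by
    rintro rfl
    obtain ⟨z, hz⟩ := hne
    simp only [Set.mem_ofPred_eq, inner_zero_right] at hx hz
    linarith
  obtain ⟨t, ht, htu⟩ := exists_inner_sub_smul_eq hu η x
  have htpos : 0 < t := by
    by_contra! h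
    linarith [mul_nonpos_of_nonpos_of_nonneg h (sq_nonneg ‖u‖)]
  refine ⟨t, htpos, ht, isProj_of_inner_le ht.le fun y hy => ?_⟩
  have hy' : inner ℝ y u ≤ η := hy
  rw [sub_sub_cancel, real_inner_smul_left, real_inner_comm, inner_sub_left, ht]
  exact mul_nonpos_of_nonneg_of_nonpos htpos.le (sub_nonpos.2 hy')

/-- A residual in the span of the normals is orthogonal to every direction inside the intersection.
-/
theorem isProj_hyperplane_inter {u v : E} {η θ : ℝ} {x p : E}
    (hu : inner ℝ p u = η) (hv : inner ℝ p v = θ)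
    (hp : x - p ∈ Submodule.span ℝ {u, v}) :
    IsProj ({x : E | inner ℝ x u = η} ∩ {x : E | inner ℝ x v = θ}) x p := by
  refine isProj_of_inner_le ⟨hu, hv⟩ fun y hy => le_of_eq ?_
  obtain ⟨hyu, hyv⟩ : inner ℝ y u = η ∧ inner ℝ y v = θ := hy
  obtain ⟨a, b, hab⟩ := Submodule.mem_span_pair.1 hp
  rw [← hab, inner_add_left, real_inner_smul_left, real_inner_smul_left, real_inner_comm,
    real_inner_comm _ v, inner_sub_left, inner_sub_left, hyu, hu, hyv, hv]
  ring

/-- The hyperplane through the midpoint `x - t • u` with normal `u` lies in the perpendicular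
bisector of the two points. -/
theorem norm_sub_eq_of_inner_eq {p x u : E} {t : ℝ}
    (h : inner ℝ p u = inner ℝ (x - t • u) u) : ‖p - (x - (2 * t) • u)‖ = ‖p - x‖ := by
  have h1 : p - (x - (2 * t) • u) = (p - x) + (2 * t) • u := by abel
  have h2 : ‖p - (x - (2 * t) • u)‖ ^ 2 = ‖p - x‖ ^ 2 := by
    rw [h1, norm_add_sq_real, real_inner_smul_right, norm_smul, mul_pow, Real.norm_eq_abs, sq_abs,
      ← real_inner_self_eq_norm_sq u, inner_sub_left, h, inner_sub_left, real_inner_smul_left]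
    ring
  exact (sq_eq_sq₀ (norm_nonneg _) (norm_nonneg _)).1 h2

theorem isCircumcenter_of_norm_eq {K : Set E} {p x : E} (hx : x ∈ K)
    (hp : p ∈ affineSpan ℝ K) (h : ∀ y ∈ K, ‖p - y‖ = ‖p - x‖) : IsCircumcenter K p := by
  refine ⟨hp, ‖p - x‖, Set.Subset.antisymm ?_ ?_⟩
  · rintro _ ⟨y, hy, rfl⟩
    exact h y hy
  · rintro _ rfl
    exact ⟨x, hx, rfl⟩

theorem isCircumcenter_pair (x u : E) (t : ℝ) :
    IsCircumcenter {x, x - (2 * t) • u} (x - t • u) := by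
  refine isCircumcenter_of_norm_eq (x := x) (by simp) ?_ ?_
  · have h := AffineMap.lineMap_mem_affineSpan_pair (k := ℝ) (1 / 2 : ℝ) x (x - (2 * t) • u)
    convert h using 1
    rw [AffineMap.lineMap_apply_module]
    module
  · rintro y (rfl | rfl)
    · rfl
    · exact norm_sub_eq_of_inner_eq rfl

theorem isCircumcenter_triple {x u v p : E} {s t : ℝ} (hs : s ≠ 0) (ht : t ≠ 0)
    (hu : inner ℝ p u = inner ℝ (x - s • u) u)
    (hv : inner ℝ p v = inner ℝ (x - (2 * s) • u - t • v) v)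
    (hp : x - p ∈ Submodule.span ℝ {u, v}) :
    IsCircumcenter {x, x - (2 * s) • u, x - (2 * s) • u - (2 * t) • v} p := by
  have h1 := norm_sub_eq_of_inner_eq hu
  refine isCircumcenter_of_norm_eq (x := x) (by simp) ?_ ?_
  · obtain ⟨a, b, hab⟩ := Submodule.mem_span_pair.1 hp
    set K : Set E := {x, x - (2 * s) • u, x - (2 * s) • u - (2 * t) • v}
    have m0 : x ∈ affineSpan ℝ K := subset_affineSpan ℝ K (by simp [K])
    have m1 : x - (2 * s) • u ∈ affineSpan ℝ K := subset_affineSpan ℝ K (by simp [K])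
    have m2 : x - (2 * s) • u - (2 * t) • v ∈ affineSpan ℝ K :=
      subset_affineSpan ℝ K (by simp [K])
    -- The edges of the triangle are `-(2 * s) • u` and `-(2 * t) • v`; these factors rescale them
    -- to `-a • u` and `-b • v`, which sum to `p - x`.
    have m := AffineSubspace.smul_vsub_vadd_mem _ (b / (2 * t)) m2 m1
      (AffineSubspace.smul_vsub_vadd_mem _ (a / (2 * s)) m1 m0 m0)
    convert m using 1
    have e1 : a / (2 * s) * (2 * s) = a := by field_simp
    have e2 : b / (2 * t) * (2 * t) = b := by field_simp
    rw [vsub_eq_sub, vsub_eq_sub, vadd_eq_add, vadd_eq_add, sub_sub_cancel_left,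
      sub_sub_cancel_left, smul_neg, smul_neg, smul_smul, smul_smul, e1, e2,
      ← sub_sub_cancel x p, ← hab]
    abel
  · rintro y (rfl | rfl | rfl)
    · rfl
    · exact h1
    · rw [norm_sub_eq_of_inner_eq hv, h1]

theorem exists_eq_smul_of_not_linearIndependent {u v : E} (hv : v ≠ 0)
    (h : ¬ LinearIndependent ℝ ![u, v]) : ∃ c : ℝ, u = c • v := by
  have h' : ¬ LinearIndependent ℝ ![v, u] := fun hi => h (LinearIndependent.pair_symm_iff.1 hi)
  rw [LinearIndependent.pair_iff' hv] at h'
  push Not at h'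
  obtain ⟨c, hc⟩ := h'
  exact ⟨c, hc.symm⟩

/-- Two hyperplanes with independent normals meet within the plane of the normals through `x`. -/
theorem exists_mem_hyperplanes {u v : E} (h : LinearIndependent ℝ ![u, v]) (η θ : ℝ) (x : E) :
    ∃ p : E, inner ℝ p u = η ∧ inner ℝ p v = θ ∧ x - p ∈ Submodule.span ℝ {u, v} := by
  have hu : u ≠ 0 := h.ne_zero 0
  have huu : inner ℝ u u ≠ (0 : ℝ) := inner_self_ne_zero.2 hu
  -- `w` is the component of `v` orthogonal to `u`
  set c : ℝ := inner ℝ u v / inner ℝ u u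
  set w : E := v - c • u with hw
  have hcu : c * inner ℝ u u = inner ℝ u v := div_mul_cancel₀ _ huu
  have hw0 : w ≠ 0 := fun h0 =>
    (LinearIndependent.pair_iff' hu).1 h c (sub_eq_zero.1 h0).symm
  have hwu : inner ℝ w u = (0 : ℝ) := by
    rw [hw, inner_sub_left, real_inner_smul_left, hcu, real_inner_comm, sub_self]
  have hwv : inner ℝ w v = inner ℝ w w := by
    conv_rhs => rw [hw, inner_sub_right, real_inner_smul_right, ← hw, hwu]
    ring
  obtain ⟨a, ha, -⟩ := exists_inner_sub_smul_eq hu η x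
  have hww : inner ℝ w w ≠ (0 : ℝ) := inner_self_ne_zero.2 hw0
  refine ⟨x - a • u - ((inner ℝ (x - a • u) v - θ) / inner ℝ w w) • w, ?_, ?_, ?_⟩
  · rw [inner_sub_left, ha, real_inner_smul_left, hwu]
    ring
  · rw [inner_sub_left, real_inner_smul_left, hwv, div_mul_cancel₀ _ hww]
    ring
  · rw [sub_sub, sub_sub_cancel]
    have mu : u ∈ Submodule.span ℝ {u, v} := Submodule.subset_span (by simp)
    have mv : v ∈ Submodule.span ℝ {u, v} := Submodule.subset_span (by simp)
    exact Submodule.add_mem _ (Submodule.smul_mem _ _ mu)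
      (Submodule.smul_mem _ _ (Submodule.sub_mem _ mv (Submodule.smul_mem _ _ mu)))

theorem circumMap_triple (f g : E → E) (x p : E) :
    circumMap {id, f, g} x = some p ↔ IsCircumcenter {x, f x, g x} p := by
  rw [circumMap, circumcenter_eq_some_iff]
  simp only [Set.image_insert_eq, Set.image_singleton, id_eq]

theorem iter_one (S : Set (E → E)) (x : E) : iter S 1 x = circumMap S x := by
  simp [iter]

/-- `iter` adds steps at the end; peeling off the first one lets a case analysis restart from a new
initial point. -/
theorem iter_succ_of_eq_some {S : Set (E → E)} {x y : E} (h : circumMap S x = some y) (k : ℕ) :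
    iter S (k + 1) x = iter S k y := by
  induction k with
  | zero => rw [iter_one, h, iter]
  | succ k ih => rw [iter, ih, iter]

theorem circumMap_of_first_eq {f g : E → E} {x u : E} {t : ℝ} (hf : f x = x)
    (hg : g x = x - (2 * t) • u) : circumMap {id, f, g} x = some (x - t • u) := by
  rw [circumMap_triple, hf, hg, Set.insert_eq_of_mem (Set.mem_insert x _)]
  exact isCircumcenter_pair x u t

theorem circumMap_of_last_eq {f g : E → E} {x u : E} {t : ℝ} (hf : f x = x - (2 * t) • u)
    (hg : g x = x) : circumMap {id, f, g} x = some (x - t • u) := by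
  rw [circumMap_triple, hf, hg, Set.pair_comm, Set.insert_eq_of_mem (Set.mem_insert x _)]
  exact isCircumcenter_pair x u t

theorem circumMap_of_eq {f g : E → E} {x u : E} {t : ℝ} (hf : f x = x - (2 * t) • u)
    (hg : g x = f x) : circumMap {id, f, g} x = some (x - t • u) := by
  rw [circumMap_triple, hg, hf, Set.pair_eq_singleton]
  exact isCircumcenter_pair x u t

/-- Three distinct points `x`, `f x`, `g x` obtained by successive reflection. -/
theorem exists_circumMap_eq_of_ne {u v : E} (h : LinearIndependent ℝ ![u, v]) {η θ : ℝ}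
    {f g : E → E} {x : E} {s t : ℝ} (hs : s ≠ 0) (ht : t ≠ 0)
    (hf : f x = x - (2 * s) • u) (hfu : inner ℝ (x - s • u) u = η)
    (hg : g x = f x - (2 * t) • v) (hgv : inner ℝ (f x - t • v) v = θ) :
    ∃ p : E, inner ℝ p u = η ∧ inner ℝ p v = θ ∧ x - p ∈ Submodule.span ℝ {u, v} ∧
      circumMap {id, f, g} x = some p := by
  obtain ⟨p, hpu, hpv, hp⟩ := exists_mem_hyperplanes h η θ x
  refine ⟨p, hpu, hpv, hp, ?_⟩
  rw [hf] at hg hgv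
  rw [circumMap_triple, hf, hg]
  exact isCircumcenter_triple hs ht (hpu.trans hfu.symm) (hpv.trans hgv.symm) hp

end

/-! ### Two hyperplanes: at most three steps. -/

section Hyperplanes

variable {E : Type*} [NormedAddCommGroup E] [InnerProductSpace ℝ E]

theorem exists_refl_hyperplane {u : E} {η : ℝ} (hne : {x : E | inner ℝ x u = η}.Nonempty)
    (x : E) : ∃ t : ℝ, inner ℝ (x - t • u) u = η ∧
      refl {x : E | inner ℝ x u = η} x = x - (2 * t) • u := by
  obtain ⟨t, ht, hp⟩ := exists_isProj_hyperplane hne x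
  exact ⟨t, ht, refl_of_isProj (convex_hyperplane u η) hp⟩

variable {u v : E} {η θ : ℝ}

/-- On `H₁`, one or two steps lead to a point of `H₁ ∩ H₂`. -/
theorem exists_iter_hyperplanes_of_mem (h : LinearIndependent ℝ ![u, v]) {y : E}
    (hy : inner ℝ y u = η) : ∃ k : ℕ, 1 ≤ k ∧ k ≤ 2 ∧ ∃ p : E, inner ℝ p u = η ∧
      inner ℝ p v = θ ∧ y - p ∈ Submodule.span ℝ {u, v} ∧
      iter {id, refl {x : E | inner ℝ x u = η},
        refl {x : E | inner ℝ x v = θ} ∘ refl {x : E | inner ℝ x u = η}} k y = some p := by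
  obtain ⟨z, hzu, hzv, -⟩ := exists_mem_hyperplanes h η θ y
  have mu : u ∈ Submodule.span ℝ {u, v} := Submodule.subset_span (by simp)
  have mv : v ∈ Submodule.span ℝ {u, v} := Submodule.subset_span (by simp)
  have hry : refl {x : E | inner ℝ x u = η} y = y := refl_of_mem (convex_hyperplane u η) hy
  obtain ⟨t, ht, hrt⟩ := exists_refl_hyperplane (u := v) (η := θ) ⟨z, hzv⟩ y
  have hstep := circumMap_of_first_eq (g := refl {x : E | inner ℝ x v = θ} ∘
    refl {x : E | inner ℝ x u = η}) hry (by rw [Function.comp_apply, hry, hrt])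
  have hyq : y - (y - t • v) ∈ Submodule.span ℝ {u, v} := by
    rw [sub_sub_cancel]
    exact Submodule.smul_mem _ _ mv
  set q : E := y - t • v
  obtain ⟨s, hs, hrs⟩ := exists_refl_hyperplane (u := u) (η := η) ⟨z, hzu⟩ q
  rcases eq_or_ne s 0 with rfl | hs0
  · refine ⟨1, le_rfl, one_le_two, q, by simpa using hs, ht, hyq, ?_⟩
    rw [iter_one, hstep]
  obtain ⟨r, hr, hrr⟩ := exists_refl_hyperplane (u := v) (η := θ) ⟨z, hzv⟩
    (refl {x : E | inner ℝ x u = η} q)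
  rcases eq_or_ne r 0 with rfl | hr0
  -- Both `q` and its mirror image lie in `H₂`, hence so does their midpoint.
  · refine ⟨2, one_le_two, le_rfl, q - s • u, hs, ?_, ?_, ?_⟩
    · rw [zero_smul, sub_zero, hrs, inner_sub_left, ht, real_inner_smul_left] at hr
      rw [inner_sub_left, ht, real_inner_smul_left]
      linarith
    · rw [← sub_add]
      exact Submodule.add_mem _ hyq (Submodule.smul_mem _ _ mu)
    · rw [iter_succ_of_eq_some hstep, iter_one]
      exact circumMap_of_eq hrs (by rw [Function.comp_apply, hrr]; simp)
  · obtain ⟨p, hpu, hpv, hqp, hp⟩ := exists_circumMap_eq_of_ne h hs0 hr0 hrs hs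
      (g := refl {x : E | inner ℝ x v = θ} ∘ refl {x : E | inner ℝ x u = η}) hrr hr
    refine ⟨2, one_le_two, le_rfl, p, hpu, hpv, ?_, ?_⟩
    · rw [← sub_add_sub_cancel y q p]
      exact Submodule.add_mem _ hyq hqp
    · rw [iter_succ_of_eq_some hstep, iter_one, hp]

theorem exists_iter_hyperplanes_of_linearIndependent (h : LinearIndependent ℝ ![u, v]) (x : E) :
    ∃ k : ℕ, 1 ≤ k ∧ k ≤ 3 ∧ ∃ p : E, inner ℝ p u = η ∧
      inner ℝ p v = θ ∧ x - p ∈ Submodule.span ℝ {u, v} ∧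
      iter {id, refl {x : E | inner ℝ x u = η},
        refl {x : E | inner ℝ x v = θ} ∘ refl {x : E | inner ℝ x u = η}} k x = some p := by
  obtain ⟨z, hzu, hzv, -⟩ := exists_mem_hyperplanes h η θ x
  have mu : u ∈ Submodule.span ℝ {u, v} := Submodule.subset_span (by simp)
  obtain ⟨s, hs, hrs⟩ := exists_refl_hyperplane (u := u) (η := η) ⟨z, hzu⟩ x
  rcases eq_or_ne s 0 with rfl | hs0
  · obtain ⟨k, hk1, hk2, hk⟩ := exists_iter_hyperplanes_of_mem (θ := θ) h (by simpa using hs)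
    exact ⟨k, hk1, by omega, hk⟩
  obtain ⟨r, hr, hrr⟩ := exists_refl_hyperplane (u := v) (η := θ) ⟨z, hzv⟩
    (refl {x : E | inner ℝ x u = η} x)
  rcases eq_or_ne r 0 with rfl | hr0
  -- This collapsed step is the projection onto `H₁`; it is the third step added to the two needed
  -- from there.
  · have hstep := circumMap_of_eq (g := refl {x : E | inner ℝ x v = θ} ∘
      refl {x : E | inner ℝ x u = η}) hrs (by rw [Function.comp_apply, hrr]; simp)
    obtain ⟨k, hk1, hk2, p, hpu, hpv, hp, hk⟩ := exists_iter_hyperplanes_of_mem (θ := θ) h hs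
    refine ⟨k + 1, by omega, by omega, p, hpu, hpv, ?_, ?_⟩
    · rw [← sub_add_sub_cancel x (x - s • u) p, sub_sub_cancel]
      exact Submodule.add_mem _ (Submodule.smul_mem _ _ mu) hp
    · rw [iter_succ_of_eq_some hstep, hk]
  · obtain ⟨p, hpu, hpv, hxp, hp⟩ := exists_circumMap_eq_of_ne h hs0 hr0 hrs hs
      (g := refl {x : E | inner ℝ x v = θ} ∘ refl {x : E | inner ℝ x u = η}) hrr hr
    exact ⟨1, le_rfl, by norm_num, p, hpu, hpv, hxp, by rw [iter_one, hp]⟩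

theorem hyperplane_zero {z : E} {η : ℝ} (hz : inner ℝ z (0 : E) = η) :
    {x : E | inner ℝ x (0 : E) = η} = Set.univ := by
  ext y
  simpa using hz

theorem halfspace_zero {z : E} {η : ℝ} (hz : inner ℝ z (0 : E) ≤ η) :
    {x : E | inner ℝ x (0 : E) ≤ η} = Set.univ := by
  ext y
  simpa using hz

theorem refl_univ (x : E) : refl (Set.univ : Set E) x = x :=
  refl_of_mem convex_univ (Set.mem_univ x)

theorem circumMap_of_first_refl {C : Set E} {f g : E → E} {x : E} (hf : f x = x)
    (hg : g x = refl C x) : circumMap {id, f, g} x = some (proj C x) := by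
  have h := circumMap_of_first_eq (t := 1) (u := x - proj C x) hf (g := g) (by
    rw [hg, refl]
    module)
  rw [h]
  congr 1
  module

theorem circumMap_of_refl_last {C : Set E} {f g : E → E} {x : E} (hf : f x = refl C x)
    (hg : g x = x) : circumMap {id, f, g} x = some (proj C x) := by
  have h := circumMap_of_last_eq (t := 1) (u := x - proj C x) (f := f) (by
    rw [hf, refl]
    module) hg
  rw [h]
  congr 1
  module

theorem circumMap_of_refl_refl {C : Set E} {f g : E → E} {x : E} (hf : f x = refl C x)
    (hg : g x = refl C x) : circumMap {id, f, g} x = some (proj C x) := by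
  have h := circumMap_of_eq (t := 1) (u := x - proj C x) (f := f) (by
    rw [hf, refl]
    module) (hg.trans hf.symm)
  rw [h]
  congr 1
  module

theorem exists_iter_hyperplanes
    (hne : ({x : E | inner ℝ x u = η} ∩ {x : E | inner ℝ x v = θ}).Nonempty) (x : E) :
    ∃ k : ℕ, 1 ≤ k ∧ k ≤ 3 ∧ iter {id, refl {x : E | inner ℝ x u = η},
      refl {x : E | inner ℝ x v = θ} ∘ refl {x : E | inner ℝ x u = η}} k x
        = some (proj ({x : E | inner ℝ x u = η} ∩ {x : E | inner ℝ x v = θ}) x) := by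
  obtain ⟨z, hzu, hzv⟩ := hne
  by_cases h : LinearIndependent ℝ ![u, v]
  · obtain ⟨k, hk1, hk2, p, hpu, hpv, hp, hk⟩ :=
      exists_iter_hyperplanes_of_linearIndependent (η := η) (θ := θ) h x
    refine ⟨k, hk1, hk2, ?_⟩
    rw [hk, (isProj_hyperplane_inter hpu hpv hp).proj_eq
      ((convex_hyperplane u η).inter (convex_hyperplane v θ))]
  · refine ⟨1, le_rfl, by norm_num, ?_⟩
    rw [iter_one]
    rcases eq_or_ne v 0 with rfl | hv
    · rw [hyperplane_zero hzv, Set.inter_univ]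
      exact circumMap_of_refl_refl rfl (refl_univ _)
    rcases eq_or_ne u 0 with rfl | hu
    · rw [hyperplane_zero hzu, Set.univ_inter]
      exact circumMap_of_first_refl (refl_univ _) (by rw [Function.comp_apply, refl_univ])
    obtain ⟨c, rfl⟩ := exists_eq_smul_of_not_linearIndependent hv h
    have hc : c ≠ 0 := by
      rintro rfl
      exact hu (zero_smul _ _)
    -- Parallel hyperplanes with a common point coincide, so the composed reflection returns to `x`.
    have hH : {x : E | inner ℝ x (c • v) = η} = {x : E | inner ℝ x v = θ} := by
      ext y
      simp only [Set.mem_ofPred_eq, real_inner_smul_right] at hzu hzv ⊢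
      rw [← hzu, ← hzv]
      exact mul_right_inj' hc
    rw [hH, Set.inter_self]
    obtain ⟨t, ht, hrt⟩ := exists_refl_hyperplane (u := v) (η := θ) ⟨z, hzv⟩ x
    refine circumMap_of_refl_last rfl ?_
    have hp : IsProj {x : E | inner ℝ x v = θ} (x - (2 * t) • v)
        (x - (2 * t) • v - (-t) • v) := by
      have e : x - (2 * t) • v - (-t) • v = x - t • v := by module
      have := isProj_hyperplane_inter (x := x - (2 * t) • v) (p := x - t • v) ht ht
        (Submodule.mem_span_pair.2 ⟨-t, 0, by module⟩)
      rwa [Set.inter_self, ← e] at this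
    rw [Function.comp_apply, hrt, refl_of_isProj (convex_hyperplane v θ) hp]
    module

end Hyperplanes

/-! ### Two halfspaces, and a hyperplane with a halfspace. -/

section Halfspaces

variable {E : Type*} [NormedAddCommGroup E] [InnerProductSpace ℝ E] {u v : E} {η θ : ℝ}

/-- With parallel boundaries, projecting a point of the first halfspace onto the second cannot leave
the first. -/
theorem proj_halfspace_inter_of_mem (h : ¬ LinearIndependent ℝ ![u, v])
    (hne : ({x : E | inner ℝ x u ≤ η} ∩ {x : E | inner ℝ x v ≤ θ}).Nonempty) {x : E}
    (hx : inner ℝ x u ≤ η) :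
    proj ({x : E | inner ℝ x u ≤ η} ∩ {x : E | inner ℝ x v ≤ θ}) x
      = proj {x : E | inner ℝ x v ≤ θ} x := by
  obtain ⟨z, hzu, hzv⟩ := hne
  simp only [Set.mem_ofPred_eq] at hzu hzv
  have hconv := (convex_halfspace u η).inter (convex_halfspace v θ)
  rcases le_or_gt (inner ℝ x v) θ with hxv | hxv
  · rw [(isProj_self (C := {x : E | inner ℝ x u ≤ η} ∩ {x : E | inner ℝ x v ≤ θ})
      ⟨hx, hxv⟩).proj_eq hconv, (isProj_self (C := {x : E | inner ℝ x v ≤ θ}) hxv).proj_eq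
      (convex_halfspace v θ)]
  obtain ⟨t, ht0, ht, hp⟩ := exists_isProj_halfspace ⟨z, hzv⟩ hxv
  rw [hp.proj_eq (convex_halfspace v θ)]
  refine (hp.mono Set.inter_subset_right ⟨?_, hp.1⟩).proj_eq hconv
  have hv : v ≠ 0 := by
    rintro rfl
    simp only [inner_zero_right] at hzv hxv
    linarith
  obtain ⟨c, rfl⟩ := exists_eq_smul_of_not_linearIndependent hv h
  simp only [Set.mem_ofPred_eq, real_inner_smul_right] at hx hzu ⊢
  rw [ht]
  -- For `c ≥ 0` compare the projection with `x`, for `c ≤ 0` with the common point `z`.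
  rcases le_total 0 c with hc | hc
  · nlinarith
  · nlinarith

theorem exists_iter_halfspaces_of_linearIndependent (h : LinearIndependent ℝ ![u, v]) (x : E) :
    ∃ k : ℕ, 1 ≤ k ∧ k ≤ 2 ∧ ∃ p ∈ {x : E | inner ℝ x u ≤ η} ∩ {x : E | inner ℝ x v ≤ θ},
      iter {id, refl {x : E | inner ℝ x u ≤ η},
        refl {x : E | inner ℝ x v ≤ θ} ∘ refl {x : E | inner ℝ x u ≤ η}} k x = some p := by
  obtain ⟨z, hzu, hzv, -⟩ := exists_mem_hyperplanes h η θ x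
  set W₁ : Set E := {x : E | inner ℝ x u ≤ η}
  set W₂ : Set E := {x : E | inner ℝ x v ≤ θ}
  have c₁ : Convex ℝ W₁ := convex_halfspace u η
  have c₂ : Convex ℝ W₂ := convex_halfspace v θ
  have out₁ : ∀ {y : E}, η < inner ℝ y u → ∃ t : ℝ, 0 < t ∧ inner ℝ (y - t • u) u = η ∧
      refl W₁ y = y - (2 * t) • u := fun hy => by
    obtain ⟨t, ht0, ht, hp⟩ := exists_isProj_halfspace ⟨z, hzu.le⟩ hy
    exact ⟨t, ht0, ht, refl_of_isProj c₁ hp⟩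
  have out₂ : ∀ {y : E}, θ < inner ℝ y v → ∃ t : ℝ, 0 < t ∧ inner ℝ (y - t • v) v = θ ∧
      refl W₂ y = y - (2 * t) • v := fun hy => by
    obtain ⟨t, ht0, ht, hp⟩ := exists_isProj_halfspace ⟨z, hzv.le⟩ hy
    exact ⟨t, ht0, ht, refl_of_isProj c₂ hp⟩
  rcases le_or_gt (inner ℝ x u) η with hx | hx
  · have hrx : refl W₁ x = x := refl_of_mem c₁ hx
    rcases le_or_gt (inner ℝ x v) θ with hxv | hxv
    · refine ⟨1, le_rfl, one_le_two, x, ⟨hx, hxv⟩, ?_⟩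
      have := circumMap_of_first_eq (t := 0) (u := u) hrx (g := refl W₂ ∘ refl W₁) (by
        rw [Function.comp_apply, hrx, refl_of_mem c₂ hxv]
        simp)
      rw [iter_one, this, zero_smul, sub_zero]
    obtain ⟨t, -, ht, hrt⟩ := out₂ hxv
    have hstep := circumMap_of_first_eq hrx (g := refl W₂ ∘ refl W₁)
      (by rw [Function.comp_apply, hrx, hrt])
    set y : E := x - t • v
    rcases le_or_gt (inner ℝ y u) η with hy | hy
    · exact ⟨1, le_rfl, one_le_two, y, ⟨hy, ht.le⟩, by rw [iter_one, hstep]⟩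
    obtain ⟨s, hs0, hs, hrs⟩ := out₁ hy
    rcases le_or_gt (inner ℝ (refl W₁ y) v) θ with hyv | hyv
    -- The new point is the midpoint of `y` and its mirror image, both in the convex `W₂`.
    · refine ⟨2, one_le_two, le_rfl, y - s • u, ⟨hs.le, ?_⟩, ?_⟩
      · rw [hrs, inner_sub_left, real_inner_smul_left, ht] at hyv
        change inner ℝ (y - s • u) v ≤ θ
        rw [inner_sub_left, real_inner_smul_left, ht]
        linarith
      · rw [iter_succ_of_eq_some hstep, iter_one]
        exact circumMap_of_eq hrs (by rw [Function.comp_apply, refl_of_mem c₂ hyv])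
    · obtain ⟨r, hr0, hr, hrr⟩ := out₂ hyv
      obtain ⟨p, hpu, hpv, -, hp⟩ := exists_circumMap_eq_of_ne h hs0.ne' hr0.ne' hrs hs
        (g := refl W₂ ∘ refl W₁) hrr hr
      exact ⟨2, one_le_two, le_rfl, p, ⟨hpu.le, hpv.le⟩,
        by rw [iter_succ_of_eq_some hstep, iter_one, hp]⟩
  · obtain ⟨s, hs0, hs, hrs⟩ := out₁ hx
    rcases le_or_gt (inner ℝ (refl W₁ x) v) θ with hxv | hxv
    · have hstep := circumMap_of_eq (g := refl W₂ ∘ refl W₁) hrs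
        (by rw [Function.comp_apply, refl_of_mem c₂ hxv])
      have hry : refl W₁ (x - s • u) = x - s • u := refl_of_mem c₁ hs.le
      have e : x - (2 * s) • u = x - s • u - s • u := by module
      rw [hrs, e] at hxv
      set y : E := x - s • u
      rcases le_or_gt (inner ℝ y v) θ with hy | hy
      · exact ⟨1, le_rfl, one_le_two, y, ⟨hs.le, hy⟩, by rw [iter_one, hstep]⟩
      obtain ⟨t, ht0, ht, hrt⟩ := out₂ hy
      refine ⟨2, one_le_two, le_rfl, y - t • v, ⟨?_, ht.le⟩, ?_⟩
      · rw [inner_sub_left, real_inner_smul_left] at hxv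
        -- Moving from `y` along `-u` enters `W₂`, so the normals form an acute angle; moving along
        -- `-v` then goes deeper into `W₁`.
        have huv : 0 < inner ℝ u v := pos_of_mul_pos_right (a := s) (by linarith) hs0.le
        change inner ℝ (y - t • v) u ≤ η
        rw [inner_sub_left, real_inner_smul_left, real_inner_comm u v, hs]
        linarith [mul_pos ht0 huv]
      · rw [iter_succ_of_eq_some hstep, iter_one]
        exact circumMap_of_first_eq hry (by rw [Function.comp_apply, hry, hrt])
    · obtain ⟨r, hr0, hr, hrr⟩ := out₂ hxv
      obtain ⟨p, hpu, hpv, -, hp⟩ := exists_circumMap_eq_of_ne h hs0.ne' hr0.ne' hrs hs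
        (g := refl W₂ ∘ refl W₁) hrr hr
      exact ⟨1, le_rfl, one_le_two, p, ⟨hpu.le, hpv.le⟩, by rw [iter_one, hp]⟩

/-- The functional given by `v` is a multiple of the one given by `u`, hence constant on the
hyperplane, so one common point decides. -/
theorem hyperplane_subset_halfspace (hu : u ≠ 0) (h : ¬ LinearIndependent ℝ ![u, v])
    (hne : ({x : E | inner ℝ x u = η} ∩ {x : E | inner ℝ x v ≤ θ}).Nonempty) :
    {x : E | inner ℝ x u = η} ⊆ {x : E | inner ℝ x v ≤ θ} := by
  obtain ⟨z, hzu, hzv⟩ := hne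
  obtain ⟨c, rfl⟩ := exists_eq_smul_of_not_linearIndependent hu
    (fun hi => h (LinearIndependent.pair_symm_iff.1 hi))
  intro y hy
  simp only [Set.mem_ofPred_eq, real_inner_smul_right] at hzu hzv hy ⊢
  rwa [hy, ← hzu]

/-- The point of `H₁ ∩ H₂` in the case distinction for a hyperplane and a halfspace. -/
theorem nonempty_hyperplane_inter (hne : {x : E | inner ℝ x u = η}.Nonempty)
    (h0 : ¬ (u = 0 ∧ v = 0)) (h : ¬ (u ≠ 0 ∧ v ≠ 0 ∧ ¬ LinearIndependent ℝ ![u, v]))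
    (hv : ¬ (v = 0 ∧ θ ≠ 0)) :
    ({x : E | inner ℝ x u = η} ∩ {x : E | inner ℝ x v = θ}).Nonempty := by
  obtain ⟨z, hz⟩ := hne
  rcases eq_or_ne v 0 with rfl | hv0
  · have hθ : θ = 0 := by
      by_contra hθ
      exact hv ⟨rfl, hθ⟩
    exact ⟨z, hz, by simp [hθ]⟩
  rcases eq_or_ne u 0 with rfl | hu0
  · obtain ⟨t, ht, -⟩ := exists_inner_sub_smul_eq hv0 θ z
    rw [hyperplane_zero hz, Set.univ_inter]
    exact ⟨_, ht⟩
  · have hi : LinearIndependent ℝ ![u, v] := by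
      by_contra hi
      exact h ⟨hu0, hv0, hi⟩
    obtain ⟨p, hpu, hpv, -⟩ := exists_mem_hyperplanes hi η θ z
    exact ⟨p, hpu, hpv⟩

/-- This gives membership of `proj` in the intersection from abstract existence; completeness enters
the argument only here. -/
theorem isProj_proj_hyperplane_inter [CompleteSpace E]
    (hne : ({x : E | inner ℝ x u = η} ∩ {x : E | inner ℝ x v = θ}).Nonempty) (x : E) :
    IsProj ({x : E | inner ℝ x u = η} ∩ {x : E | inner ℝ x v = θ}) x
      (proj ({x : E | inner ℝ x u = η} ∩ {x : E | inner ℝ x v = θ}) x) :=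
  (proj_eq_iff hne
    ((isClosed_eq (by fun_prop) continuous_const).inter
      (isClosed_eq (by fun_prop) continuous_const))
    ((convex_hyperplane u η).inter (convex_hyperplane v θ)) x _).1 rfl

end Halfspaces

end CRM

/-! ### Assembly of the cases. -/

open CRM in
theorem mainTheorem3 {E : Type*} [NormedAddCommGroup E] [InnerProductSpace ℝ E] [CompleteSpace E]
    (u₁ u₂ : E) (η₁ η₂ : ℝ) (W₁ W₂ H₁ H₂ : Set E)
    (hW₁ : W₁ = {x : E | inner ℝ x u₁ ≤ η₁}) (hW₂ : W₂ = {x : E | inner ℝ x u₂ ≤ η₂})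
    (hH₁ : H₁ = {x : E | inner ℝ x u₁ = η₁}) (hH₂ : H₂ = {x : E | inner ℝ x u₂ = η₂}) :
    -- two hyperplanes
    ((H₁ ∩ H₂).Nonempty → ∀ x : E, ∃ k : ℕ, 1 ≤ k ∧ k ≤ 3 ∧
      CRM.iter {id, CRM.refl H₁, CRM.refl H₂ ∘ CRM.refl H₁} k x
        = some (CRM.proj (H₁ ∩ H₂) x)) ∧
    -- two halfspaces, dependent normals
    (¬ LinearIndependent ℝ ![u₁, u₂] → (W₁ ∩ W₂).Nonempty → ∀ x ∈ W₁ ∪ W₂,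
      CRM.iter {id, CRM.refl W₁, CRM.refl W₂} 1 x = some (CRM.proj (W₁ ∩ W₂) x)) ∧
    (¬ LinearIndependent ℝ ![u₁, u₂] → (W₁ ∩ W₂).Nonempty → ∀ x ∈ W₁,
      CRM.iter {id, CRM.refl W₁, CRM.refl W₂ ∘ CRM.refl W₁} 1 x
        = some (CRM.proj (W₁ ∩ W₂) x)) ∧
    -- two halfspaces, independent normals
    (LinearIndependent ℝ ![u₁, u₂] → ∀ x : E, ∃ k : ℕ, 1 ≤ k ∧ k ≤ 2 ∧ ∃ p ∈ W₁ ∩ W₂,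
      CRM.iter {id, CRM.refl W₁, CRM.refl W₂ ∘ CRM.refl W₁} k x = some p) ∧
    -- a hyperplane and a halfspace
    ((H₁ ∩ W₂).Nonempty →
      ((u₁ = 0 ∨ u₂ = 0) → ∀ x : E,
        CRM.circumMap {id, CRM.refl H₁, CRM.refl W₂} x = some (CRM.proj (H₁ ∩ W₂) x) ∧
        CRM.circumMap {id, CRM.refl H₁, CRM.refl W₂ ∘ CRM.refl H₁} x
          = some (CRM.proj (H₁ ∩ W₂) x) ∧
        CRM.circumMap {id, CRM.refl W₂, CRM.refl H₁ ∘ CRM.refl W₂} x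
          = some (CRM.proj (H₁ ∩ W₂) x)) ∧
      (u₁ ≠ 0 → u₂ ≠ 0 → ¬ LinearIndependent ℝ ![u₁, u₂] → ∀ x : E,
        CRM.proj H₁ x = CRM.proj (H₁ ∩ W₂) x) ∧
      (¬ (u₁ = 0 ∧ u₂ = 0) → ¬ (u₁ ≠ 0 ∧ u₂ ≠ 0 ∧ ¬ LinearIndependent ℝ ![u₁, u₂]) →
        ¬ (u₂ = 0 ∧ η₂ ≠ 0) →
        (H₁ ∩ H₂).Nonempty ∧ ∀ x : E, CRM.proj (H₁ ∩ H₂) x ∈ H₁ ∩ W₂ ∧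
          ∃ k : ℕ, 1 ≤ k ∧ k ≤ 3 ∧
            CRM.iter {id, CRM.refl H₁, CRM.refl H₂ ∘ CRM.refl H₁} k x
              = some (CRM.proj (H₁ ∩ H₂) x))) := by
  subst hW₁ hW₂ hH₁ hH₂
  refine ⟨fun hne x => exists_iter_hyperplanes hne x, ?_, ?_,
    fun h x => exists_iter_halfspaces_of_linearIndependent h x, fun hne => ⟨?_, ?_, ?_⟩⟩
  · intro h hne x hx
    rw [iter_one]
    rcases hx with hx | hx
    · rw [proj_halfspace_inter_of_mem h hne hx]
      exact circumMap_of_first_refl (refl_of_mem (convex_halfspace u₁ η₁) hx) rfl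
    · rw [Set.inter_comm] at hne ⊢
      rw [proj_halfspace_inter_of_mem
        (fun hi => h (LinearIndependent.pair_symm_iff.1 hi)) hne hx]
      exact circumMap_of_refl_last rfl (refl_of_mem (convex_halfspace u₂ η₂) hx)
  · intro h hne x hx
    have hrx := refl_of_mem (convex_halfspace u₁ η₁) hx
    rw [iter_one, proj_halfspace_inter_of_mem h hne hx]
    exact circumMap_of_first_refl hrx (by rw [Function.comp_apply, hrx])
  · obtain ⟨z, hz₁, hz₂⟩ := hne
    rintro (rfl | rfl) x
    · rw [hyperplane_zero hz₁, Set.univ_inter]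
      exact ⟨circumMap_of_first_refl (refl_univ x) rfl,
        circumMap_of_first_refl (refl_univ x) (by rw [Function.comp_apply, refl_univ]),
        circumMap_of_refl_refl rfl (refl_univ _)⟩
    · rw [halfspace_zero hz₂, Set.inter_univ]
      exact ⟨circumMap_of_refl_last rfl (refl_univ x),
        circumMap_of_refl_refl rfl (refl_univ _),
        circumMap_of_first_refl (refl_univ x) (by rw [Function.comp_apply, refl_univ])⟩
  · intro hu₁ _ h x
    rw [Set.inter_eq_left.2 (hyperplane_subset_halfspace hu₁ h hne)]
  · intro h0 h hv
    have hne' := nonempty_hyperplane_inter (hne.mono Set.inter_subset_left) h0 h hv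
    refine ⟨hne', fun x => ⟨?_, exists_iter_hyperplanes hne' x⟩⟩
    have hp := (isProj_proj_hyperplane_inter hne' x).1
    exact ⟨hp.1, (show inner ℝ _ u₂ = η₂ from hp.2).le⟩
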